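/- Let $d \in \mathbb{N} \cup \{\infty\}$ and let $\mathbb{C}^d$ carry its Euclidean inner product $\langle\cdot,\cdot\rangle$, linear in the first variable, where $\mathbb{C}^\infty$ means $\ell^2$. Let $\mathbb{B}_d$ be the open unit ball of $\mathbb{C}^d$. Let $\gamma \in (0,\infty)$ and let $\mathcal{H}_\gamma$ be the reproducing kernel Hilbert space of functions on $\mathbb{B}_d$ with kernel $$K(z,w) = \frac{1}{(1-\langle z,w\rangle)^\gamma},$$ where the power is the principal one. For $a \in \mathbb{B}_d$, let $P_a$ be the orthogonal projection of $\mathbb{C}^d$ onto the linear span of $a$, let $Q_a = I - P_a$ and $s_a = (1-\|a\|^2)^{1/2}$, and let $$\varphi_a(z) = \frac{a - P_a z - s_a Q_a z}{1-\langle z,a\rangle} \quad (z \in \mathbb{B}_d).$$ Let $\phi : \mathbb{B}_d \to \mathbb{B}_d$ and $\delta : \mathbb{B}_d \to \mathbb{C}$ be arbitrary maps. The following are equivalent: (i) the weighted composition operator $W_{\delta,\phi} : f \mapsto \delta\cdot(f\circ\phi)$ is a (well-defined, bounded) co-isometry on $\mathcal{H}_\gamma$, that is, $W_{\delta,\phi}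 W_{\delta,\phi}^* = I$; (ii) there exist $a \in \mathbb{B}_d$, a linear isometry $V$ of $\mathbb{C}^d$ into itself (not necessarily surjective), and $\mu \in \mathbb{C}$ with $|\mu| = 1$ such that, for all $z \in \mathbb{B}_d$, $$\phi(z) = \varphi_a(Vz) \quad\text{and}\quad \delta(z) = \mu\,\frac{K(Vz,a)}{K(a,a)^{1/2}}.$$ -/

import Mathlib

noncomputable section

/-- For `d ∈ ℕ ∪ {∞}`, the Hilbert space `ℂ^d` with its Euclidean norm: the square-summable families
`(z_i)` indexed by the natural numbers `i < d`. For `d = ∞` this is `ℓ²`. -/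
abbrev Cd (d : ℕ∞) : Type := lp (fun _ : {i : ℕ // (i : ℕ∞) < d} => ℂ) 2

section Ball

variable (E : Type*) [NormedAddCommGroup E] [InnerProductSpace ℂ E]

/-- The open unit ball of a complex Hilbert space. -/
abbrev UnitBall : Type _ := {z : E // ‖z‖ < 1}

variable {E}

/-- The kernel `K(z,w) = 1 / (1 - ⟨z,w⟩) ^ γ`. Here `⟨z,w⟩` is linear in the first variable,
so that it is Mathlib's `inner ℂ w z`; the power is the principal one (for `z, w` in the ball, the
base has positive real part). -/
def gammaKernel (γ : ℝ) (z w : E) : ℂ := 1 / (1 - inner ℂ w z) ^ (γ : ℂ)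

/-- `φ_a(z) = (a - P_a z - s_a Q_a z) / (1 - ⟨z,a⟩)`, with `P_a` the orthogonal projection onto the
span of `a`, `Q_a = I - P_a` and `s_a = (1 - ‖a‖²)^{1/2}`. -/
def ballInvolution (a z : E) : E :=
  (1 - inner ℂ a z)⁻¹ •
    (a - (ℂ ∙ a).starProjection z
      - (Real.sqrt (1 - ‖a‖ ^ 2) : ℂ) • (z - (ℂ ∙ a).starProjection z))

variable (E) in
/-- The kernel `K` on the ball, with scalars read as operators on `ℂ`. -/
def gammaKernelMatrix (γ : ℝ) : Matrix (UnitBall E) (UnitBall E) (ℂ →L[ℂ] ℂ) :=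
  Matrix.of fun z w => gammaKernel γ (z : E) (w : E) • ContinuousLinearMap.id ℂ ℂ

open scoped ComplexOrder in
theorem inner_pow_posSemidef {X : Type*} (e : X → E) (n : ℕ) (s : Finset X) (v : X → ℂ) :
    0 ≤ (∑ x ∈ s, ∑ y ∈ s, star (v x) * inner ℂ (e x) (e y) ^ n * v y).re := by
  classical
  have key : ∀ n : ℕ, (Matrix.of fun x y : s =>
      (inner ℂ (e x) (e y) : ℂ) ^ n).PosSemidef := by
    intro n
    induction n with
    | zero =>
      convert! Matrix.posSemidef_gram ℂ (fun _ : s => (1 : ℂ)) using 1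
      ext x y
      simp
    | succ k ih =>
      convert! ih.hadamard (Matrix.posSemidef_gram ℂ (fun x : s => e x)) using 1
  have h := (key n).re_dotProduct_nonneg (fun x : s => v x)
  convert! h using 2
  simp only [dotProduct, Matrix.mulVec, Matrix.of_apply, Finset.mul_sum]
  rw [← Finset.sum_coe_sort s]
  refine Finset.sum_congr rfl fun x _ => ?_
  rw [← Finset.sum_coe_sort s]
  refine Finset.sum_congr rfl fun y _ => ?_
  simp [mul_assoc]

theorem gamma_coeff_nonneg {γ : ℝ} (hγ : 0 < γ) (n : ℕ) :
    0 ≤ Ring.choose (γ + n - 1) n := by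
  rw [← Ring.multichoose_eq]
  have h := Ring.factorial_nsmul_multichoose_eq_ascPochhammer γ n
  rw [Polynomial.ascPochhammer_smeval_eq_eval] at h
  have h2 := ascPochhammer_pos n γ hγ
  rw [← h, nsmul_eq_mul] at h2
  exact (pos_of_mul_pos_right h2 (by positivity)).le

theorem gammaKernel_hasSum (γ : ℝ) (z w : UnitBall E) :
    HasSum (fun n : ℕ => ((Ring.choose (γ + n - 1) n : ℝ) : ℂ) * inner ℂ (w : E) (z : E) ^ n)
      (gammaKernel γ (z : E) (w : E)) := by
  have hlt : ‖(inner ℂ (w : E) (z : E) : ℂ)‖ < 1 :=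
    lt_of_le_of_lt (norm_inner_le_norm _ _)
      (mul_lt_one_of_nonneg_of_lt_one_left (norm_nonneg _) w.2 z.2.le)
  have h := (Complex.one_div_one_sub_cpow_hasFPowerSeriesOnBall_zero (γ : ℂ)).hasSum
    (y := inner ℂ (w : E) (z : E)) (by
      simpa [Metric.mem_eball, edist_zero_right, enorm_eq_nnnorm, ← NNReal.coe_lt_coe] using hlt)
  simp only [zero_add] at h
  convert! h using 1
  funext n
  have hc : ((Ring.choose (γ + n - 1) n : ℝ) : ℂ) = Ring.choose ((γ : ℂ) + n - 1) n := by
    rw [Complex.ofReal_choose]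
    push_cast
    rfl
  rw [hc]
  simp [mul_comm]

variable (E) in
theorem gammaKernelMatrix_posSemidef {γ : ℝ} (hγ : 0 < γ) :
    (gammaKernelMatrix E γ).PosSemidef := by
  refine ((RKHS.posSemidef_tfae (K := gammaKernelMatrix E γ)).out 0 2).mpr ?_
  refine ⟨?_, fun v => ?_⟩
  · ext z w
    have h1 := (gammaKernel_hasSum γ w z).star
    have h2 := gammaKernel_hasSum γ z w
    have h3 : star (gammaKernel γ (w : E) (z : E)) = gammaKernel γ (z : E) (w : E) := by
      refine h1.unique ?_
      convert! h2 using 1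
      funext n
      simp
    have h4 : star (gammaKernelMatrix E γ w z) = gammaKernelMatrix E γ z w := by
      simp only [gammaKernelMatrix, Matrix.of_apply]
      rw [← h3, star_smul]
      congr 1
      exact ContinuousLinearMap.adjoint_id
    simp only [Matrix.conjTranspose_apply, h4]
  · have hs : HasSum (fun n : ℕ => Ring.choose (γ + n - 1) n *
        (∑ x ∈ v.support, ∑ y ∈ v.support,
          v x * inner ℂ (x : E) (y : E) ^ n * star (v y)).re)
        (∑ x ∈ v.support, ∑ y ∈ v.support,
          v x * gammaKernel γ (y : E) (x : E) * star (v y)).re := by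
      have h : HasSum (fun n : ℕ => ∑ x ∈ v.support, ∑ y ∈ v.support,
          v x * (((Ring.choose (γ + n - 1) n : ℝ) : ℂ) * inner ℂ (x : E) (y : E) ^ n) * star (v y))
          (∑ x ∈ v.support, ∑ y ∈ v.support,
            v x * gammaKernel γ (y : E) (x : E) * star (v y)) :=
        hasSum_sum fun x _ => hasSum_sum fun y _ =>
          ((gammaKernel_hasSum γ y x).mul_left _).mul_right _
      convert! Complex.hasSum_re h using 1
      funext n
      rw [← Complex.re_ofReal_mul, Finset.mul_sum]
      congr 1
      refine Finset.sum_congr rfl fun x _ => ?_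
      rw [Finset.mul_sum]
      refine Finset.sum_congr rfl fun y _ => ?_
      ring
    have hn := hs.nonneg fun n => mul_nonneg (gamma_coeff_nonneg hγ n) (by
      simpa using inner_pow_posSemidef (fun x : UnitBall E => (x : E)) n v.support
        (fun x => star (v x)))
    have hre : (∑ x ∈ v.support, ∑ y ∈ v.support,
          v x * gammaKernel γ (y : E) (x : E) * star (v y)).re =
        (∑ x ∈ v.support, ∑ y ∈ v.support,
          inner ℂ (gammaKernel γ (y : E) (x : E) * v x) (v y)).re := by
      simp only [Complex.re_sum]
      refine Finset.sum_congr rfl fun x _ => Finset.sum_congr rfl fun y _ => ?_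
      rw [← Complex.conj_re]
      congr 1
      simp [mul_comm, mul_left_comm]
    rw [hre] at hn
    simpa [Finsupp.sum, gammaKernelMatrix] using hn

variable (E) in
/-- The space `H_γ`: the reproducing kernel Hilbert space on the unit ball with kernel
`1 / (1 - ⟨z,w⟩) ^ γ`, for `γ > 0`. It is the space that the positive semidefinite kernel generates;
its elements `f` are used as functions `z ↦ f z` on the ball. -/
def HGamma {γ : ℝ} (hγ : 0 < γ) : Type _ :=
  haveI : Fact (gammaKernelMatrix E γ).PosSemidef := ⟨gammaKernelMatrix_posSemidef E hγ⟩
  RKHS.OfKernel (gammaKernelMatrix E γ)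

namespace HGamma

variable {γ : ℝ} (hγ : 0 < γ)

instance : NormedAddCommGroup (HGamma E hγ) :=
  haveI : Fact (gammaKernelMatrix E γ).PosSemidef := ⟨gammaKernelMatrix_posSemidef E hγ⟩
  inferInstanceAs (NormedAddCommGroup (RKHS.OfKernel (gammaKernelMatrix E γ)))

instance : InnerProductSpace ℂ (HGamma E hγ) :=
  haveI : Fact (gammaKernelMatrix E γ).PosSemidef := ⟨gammaKernelMatrix_posSemidef E hγ⟩
  inferInstanceAs (InnerProductSpace ℂ (RKHS.OfKernel (gammaKernelMatrix E γ)))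

instance : CompleteSpace (HGamma E hγ) :=
  haveI : Fact (gammaKernelMatrix E γ).PosSemidef := ⟨gammaKernelMatrix_posSemidef E hγ⟩
  inferInstanceAs (CompleteSpace (RKHS.OfKernel (gammaKernelMatrix E γ)))

instance : RKHS ℂ (HGamma E hγ) (UnitBall E) ℂ :=
  haveI : Fact (gammaKernelMatrix E γ).PosSemidef := ⟨gammaKernelMatrix_posSemidef E hγ⟩
  inferInstanceAs (RKHS ℂ (RKHS.OfKernel (gammaKernelMatrix E γ)) (UnitBall E) ℂ)

/-- The reproducing kernel of `H_γ` is the prescribed one. -/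
theorem kernel_eq : RKHS.kernel (HGamma E hγ) = gammaKernelMatrix E γ :=
  haveI : Fact (gammaKernelMatrix E γ).PosSemidef := ⟨gammaKernelMatrix_posSemidef E hγ⟩
  RKHS.OfKernel.kernel_ofKernel

end HGamma

end Ball

/-- The weighted composition operator `W_{δ,φ} : f ↦ δ · (f ∘ φ)` is a (well-defined, bounded)
co-isometry `W W* = I` on the reproducing kernel Hilbert space `H` of functions on `X`. -/
def IsCoisometricWCO {X : Type*} (H : Type*) [NormedAddCommGroup H] [InnerProductSpace ℂ H]
    [CompleteSpace H] [RKHS ℂ H X ℂ] (δ : X → ℂ) (φ : X → X) : Prop :=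
  ∃ W : H →L[ℂ] H, (∀ (f : H) (x : X), (W f) x = δ x * f (φ x)) ∧
    W ∘L ContinuousLinearMap.adjoint W = ContinuousLinearMap.id ℂ H

end

/-! ### Co-isometric weighted composition operators and kernel covariance. -/

section CoisometricWCO

open ContinuousLinearMap

variable {X H : Type*} [NormedAddCommGroup H] [InnerProductSpace ℂ H] [CompleteSpace H]
  [RKHS ℂ H X ℂ]

/-! If `W` is bounded, `W*` sends the kernel function at `y` to `conj (δ y)` times the one at `φ y`.
So `W W* = I` says exactly that `δ z * conj (δ w) * K (φ z) (φ w) = K z w` (`isCoisometricWCO_iff`).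
What remains is to solve this equation on the ball.

Every claimed pair solves it: raise `(1 - ⟨φ_a z, φ_a w⟩)(1 - ⟨z,a⟩)(1 - ⟨a,w⟩) = (1 - ‖a‖²)(1 -
⟨z,w⟩)` to the power `γ` (`gammaKernel_ballInvolution`).

Conversely, put `a = φ 0` and `ψ = φ_a ∘ φ`, so `ψ 0 = 0`. The equation at `w = 0` determines `δ` up
to a unimodular constant, and then `K (ψ z) (ψ w) = K z w`. Removing the power `γ` by a continuity
argument (`inner_eq_of_gammaKernel_eq`) shows that `ψ` preserves inner products, hence is the
restriction of a linear isometry. -/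

theorem RKHS.inner_kerFun_kerFun_one (x y : X) :
    inner ℂ (RKHS.kerFun H x (1 : ℂ)) (RKHS.kerFun H y (1 : ℂ)) = RKHS.kernel H x y 1 := by
  rw [RKHS.kerFun_inner, RKHS.kerFun_apply]
  simp

variable (H) in
-- Values are scalars, so the vectors `kerFun x 1` already span all `kerFun x v`.
theorem RKHS.denseRange_linearCombination_kerFun :
    DenseRange (Finsupp.linearCombination ℂ fun x : X => RKHS.kerFun H x (1 : ℂ)) := by
  have hle : Submodule.span ℂ {RKHS.kerFun H x v | (x : X) (v : ℂ)} ≤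
      LinearMap.range (Finsupp.linearCombination ℂ fun x : X => RKHS.kerFun H x (1 : ℂ)) := by
    rw [Submodule.span_le]
    rintro _ ⟨x, v, rfl⟩
    refine ⟨Finsupp.single x v, ?_⟩
    rw [Finsupp.linearCombination_single, ← map_smul, smul_eq_mul, mul_one]
  have h := Submodule.topologicalClosure_mono hle
  rw [RKHS.kerFun_dense, top_le_iff] at h
  rw [DenseRange, dense_iff_closure_eq]
  exact congrArg (fun s : Submodule ℂ H => (s : Set H)) h

/-- Vectors with the Gram matrix of a family of kernel functions are the image of that family
under an isometry. -/
theorem RKHS.exists_linearIsometry_kerFun (v : X → H)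
    (hv : ∀ x y, inner ℂ (v x) (v y) = RKHS.kernel H x y 1) :
    ∃ T : H →ₗᵢ[ℂ] H, ∀ x, T (RKHS.kerFun H x (1 : ℂ)) = v x := by
  set e := Finsupp.linearCombination ℂ fun x : X => RKHS.kerFun H x (1 : ℂ) with he
  set f := Finsupp.linearCombination ℂ v with hf
  -- Norms of combinations depend only on the Gram matrix; hence `e c ↦ f c` is well defined even if
  -- the kernel functions are linearly dependent.
  have hnorm : ∀ c, ‖f c‖ = ‖e c‖ := by
    intro c
    have h : inner ℂ (f c) (f c) = inner ℂ (e c) (e c) := by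
      simp only [hf, he, Finsupp.linearCombination_apply, Finsupp.sum_inner, Finsupp.inner_sum,
        inner_smul_left, inner_smul_right, hv, RKHS.inner_kerFun_kerFun_one]
    rw [@norm_eq_sqrt_re_inner ℂ, @norm_eq_sqrt_re_inner ℂ, h]
  have hd : DenseRange e := RKHS.denseRange_linearCombination_kerFun H
  have hext := LinearMap.extendOfNorm_eq hd ⟨1, fun c => by rw [one_mul, hnorm]⟩
  refine ⟨⟨(f.extendOfNorm e).toLinearMap, fun x => ?_⟩, fun x => ?_⟩
  · refine hd.induction_on (p := fun x => ‖f.extendOfNorm e x‖ = ‖x‖) x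
      (isClosed_eq (by fun_prop) (by fun_prop)) fun c => ?_
    rw [hext, hnorm]
  · have h := hext (Finsupp.single x 1)
    rw [he, hf, Finsupp.linearCombination_single, Finsupp.linearCombination_single, one_smul,
      one_smul] at h
    exact h

/-- A weighted composition operator is a co-isometry if and only if the kernel is covariant. -/
theorem isCoisometricWCO_iff (δ : X → ℂ) (φ : X → X) :
    IsCoisometricWCO H δ φ ↔
      ∀ x y, δ x * star (δ y) * RKHS.kernel H (φ x) (φ y) 1 = RKHS.kernel H x y 1 := by
  constructor
  · rintro ⟨W, hW, hWW⟩ x y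
    have hadj : adjoint W (RKHS.kerFun H y (1 : ℂ)) =
        star (δ y) • RKHS.kerFun H (φ y) (1 : ℂ) := by
      refine ext_inner_right ℂ fun f => ?_
      rw [adjoint_inner_left, RKHS.kerFun_inner, inner_smul_left, RKHS.kerFun_inner, hW]
      simp
    have h := congrArg (fun f : H => f x) (DFunLike.congr_fun hWW (RKHS.kerFun H y (1 : ℂ)))
    simp only [comp_apply, id_apply, hW, hadj, RKHS.coe_smul, Pi.smul_apply, RKHS.kerFun_apply,
      smul_eq_mul] at h
    rw [mul_assoc, h]
  · intro h
    obtain ⟨T, hT⟩ := RKHS.exists_linearIsometry_kerFun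
      (fun x => star (δ x) • RKHS.kerFun H (φ x) (1 : ℂ)) fun x y => by
        rw [inner_smul_left, inner_smul_right, RKHS.inner_kerFun_kerFun_one, ← h x y]
        simp [mul_assoc]
    -- `W = T*`, so `W W* = T* T = I` because `T` is isometric.
    refine ⟨adjoint T.toContinuousLinearMap, fun f x => ?_, ?_⟩
    · have h1 : (adjoint T.toContinuousLinearMap f) x =
          inner ℂ (RKHS.kerFun H x (1 : ℂ)) (adjoint T.toContinuousLinearMap f) := by
        rw [RKHS.kerFun_inner]
        simp
      rw [h1, adjoint_inner_right, LinearIsometry.coe_toContinuousLinearMap, hT, inner_smul_left,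
        RKHS.kerFun_inner]
      simp
    · refine ContinuousLinearMap.ext fun f => ext_inner_right ℂ fun g => ?_
      rw [comp_apply, adjoint_inner_left, adjoint_adjoint]
      simp

end CoisometricWCO

/-! ### Algebra of the ball involution. -/

section BallInvolution

variable {E : Type*} [NormedAddCommGroup E] [InnerProductSpace ℂ E]

theorem re_one_sub_inner_pos {z w : E} (hz : ‖z‖ < 1) (hw : ‖w‖ < 1) :
    0 < (1 - inner ℂ w z).re := by
  have h1 : ‖(inner ℂ w z : ℂ)‖ < 1 :=
    (norm_inner_le_norm w z).trans_lt (mul_lt_one_of_nonneg_of_lt_one_left (norm_nonneg _) hw hz.le)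
  have h2 := Complex.re_le_norm (inner ℂ w z)
  rw [Complex.sub_re, Complex.one_re]
  linarith

theorem one_sub_inner_ne_zero {z w : E} (hz : ‖z‖ < 1) (hw : ‖w‖ < 1) :
    (1 - inner ℂ w z : ℂ) ≠ 0 := fun h => by
  simpa [h] using re_one_sub_inner_pos hz hw

theorem inner_starProjection_singleton_self (a z : E) :
    inner ℂ a ((ℂ ∙ a).starProjection z) = inner ℂ a z := by
  rw [← Submodule.inner_starProjection_left_eq_right,
    Submodule.starProjection_eq_self_iff.mpr (Submodule.mem_span_singleton_self a)]

theorem ofReal_sqrt_one_sub_sq {r : ℝ} (h0 : 0 ≤ r) (h1 : r < 1) :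
    (Real.sqrt (1 - r ^ 2) : ℂ) ^ 2 = 1 - (r : ℂ) ^ 2 := by
  rw [← Complex.ofReal_pow, Real.sq_sqrt (by nlinarith)]
  push_cast
  rfl

theorem one_sub_norm_sq_ne_zero {a : E} (ha : ‖a‖ < 1) : (1 - (‖a‖ : ℂ) ^ 2) ≠ 0 := by
  have h := one_sub_inner_ne_zero ha ha
  rwa [inner_self_eq_norm_sq_to_K] at h

theorem one_sub_inner_ballInvolution {a z w : E} (ha : ‖a‖ < 1) (hz : ‖z‖ < 1) (hw : ‖w‖ < 1) :
    (1 - inner ℂ (ballInvolution a w) (ballInvolution a z)) *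
        ((1 - inner ℂ a z) * (1 - inner ℂ w a)) =
      (1 - (‖a‖ : ℂ) ^ 2) * (1 - inner ℂ w z) := by
  have hz0 := one_sub_inner_ne_zero hz ha
  have hw0 := one_sub_inner_ne_zero ha hw
  have hs := ofReal_sqrt_one_sub_sq (norm_nonneg a) ha
  set s := Real.sqrt (1 - ‖a‖ ^ 2)
  have hnum : inner ℂ
      (a - (ℂ ∙ a).starProjection w - (s : ℂ) • (w - (ℂ ∙ a).starProjection w))
      (a - (ℂ ∙ a).starProjection z - (s : ℂ) • (z - (ℂ ∙ a).starProjection z)) =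
      (‖a‖ : ℂ) ^ 2 - inner ℂ a z - inner ℂ w a + (1 - (‖a‖ : ℂ) ^ 2) * inner ℂ w z
        + inner ℂ w a * inner ℂ a z := by
    have haz := inner_starProjection_singleton_self a z
    have hwa : inner ℂ ((ℂ ∙ a).starProjection w) a = inner ℂ w a := by
      rw [← inner_conj_symm, inner_starProjection_singleton_self, inner_conj_symm]
    have hwz : inner ℂ ((ℂ ∙ a).starProjection w) ((ℂ ∙ a).starProjection z) =
        inner ℂ w ((ℂ ∙ a).starProjection z) := by
      rw [Submodule.inner_starProjection_left_eq_right,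
        Submodule.starProjection_eq_self_iff.mpr (Submodule.starProjection_apply_mem _ z)]
    have hwz' : inner ℂ ((ℂ ∙ a).starProjection w) z =
        inner ℂ w ((ℂ ∙ a).starProjection z) :=
      Submodule.inner_starProjection_left_eq_right _ _ _
    -- The formula for `P_a` with its denominator cleared, which also covers `a = 0`.
    have hsm : (‖a‖ : ℂ) ^ 2 * inner ℂ w ((ℂ ∙ a).starProjection z) =
        inner ℂ w a * inner ℂ a z := by
      have h := congrArg (inner ℂ w) (Submodule.smul_starProjection_singleton ℂ (v := a) z)
      rw [inner_smul_right, inner_smul_right] at h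
      rw [mul_comm (inner ℂ w a), ← h]
      norm_num
    have haa : (inner ℂ a a : ℂ) = (‖a‖ : ℂ) ^ 2 := inner_self_eq_norm_sq_to_K a
    simp only [inner_sub_left, inner_sub_right, inner_smul_left, inner_smul_right, haz, hwa, hwz,
      hwz', haa, Complex.conj_ofReal]
    linear_combination (inner ℂ w z - inner ℂ w ((ℂ ∙ a).starProjection z)) * hs + hsm
  have hconj : (starRingEnd ℂ) (1 - inner ℂ a w)⁻¹ = (1 - inner ℂ w a)⁻¹ := by
    rw [map_inv₀, map_sub, map_one, inner_conj_symm]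
  rw [ballInvolution, ballInvolution, inner_smul_left, inner_smul_right, hconj, hnum]
  field_simp
  ring

/-- The case `w = z` of `one_sub_inner_ballInvolution` writes `1 - ‖φ_a z‖²` as a quotient of
positive numbers. -/
theorem norm_ballInvolution_lt_one {a z : E} (ha : ‖a‖ < 1) (hz : ‖z‖ < 1) :
    ‖ballInvolution a z‖ < 1 := by
  have h := one_sub_inner_ballInvolution ha hz hz
  have hconj : (1 - inner ℂ z a : ℂ) = (starRingEnd ℂ) (1 - inner ℂ a z) := by
    rw [map_sub, map_one, inner_conj_symm]
  have hsq : ∀ x : E, (inner ℂ x x : ℂ) = (‖x‖ : ℂ) ^ 2 := fun x => inner_self_eq_norm_sq_to_K x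
  rw [hconj, Complex.mul_conj, hsq, hsq] at h
  have h' : (1 - ‖ballInvolution a z‖ ^ 2) * Complex.normSq (1 - inner ℂ a z) =
      (1 - ‖a‖ ^ 2) * (1 - ‖z‖ ^ 2) := by
    exact_mod_cast h
  have hn : 0 < Complex.normSq (1 - inner ℂ a z) :=
    Complex.normSq_pos.mpr (one_sub_inner_ne_zero hz ha)
  have hp : 0 < (1 - ‖a‖ ^ 2) * (1 - ‖z‖ ^ 2) :=
    mul_pos (by nlinarith [norm_nonneg a]) (by nlinarith [norm_nonneg z])
  rw [← h'] at hp
  have := pos_of_mul_pos_left hp hn.le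
  nlinarith [norm_nonneg (ballInvolution a z)]

theorem ballInvolution_self (a : E) : ballInvolution a a = 0 := by
  rw [ballInvolution,
    Submodule.starProjection_eq_self_iff.mpr (Submodule.mem_span_singleton_self a)]
  simp

theorem ballInvolution_ballInvolution {a z : E} (ha : ‖a‖ < 1) (hz : ‖z‖ < 1) :
    ballInvolution a (ballInvolution a z) = z := by
  have hc := one_sub_inner_ne_zero hz ha
  have hs := ofReal_sqrt_one_sub_sq (norm_nonneg a) ha
  have ha0 := one_sub_norm_sq_ne_zero ha
  have hPa := Submodule.starProjection_eq_self_iff.mpr (Submodule.mem_span_singleton_self (R := ℂ) a)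
  have hPP : (ℂ ∙ a).starProjection ((ℂ ∙ a).starProjection z) = (ℂ ∙ a).starProjection z :=
    Submodule.starProjection_eq_self_iff.mpr (Submodule.starProjection_apply_mem _ z)
  have hsm : ((‖a‖ : ℂ) ^ 2) • (ℂ ∙ a).starProjection z = (inner ℂ a z : ℂ) • a := by
    rw [← Submodule.smul_starProjection_singleton ℂ (v := a) z]
    norm_num
  have hP : (ℂ ∙ a).starProjection (ballInvolution a z) =
      (1 - inner ℂ a z)⁻¹ • (a - (ℂ ∙ a).starProjection z) := by
    rw [ballInvolution, map_smul, map_sub, map_sub, map_smul, map_sub, hPa, hPP, sub_self,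
      smul_zero, sub_zero]
  have hin : 1 - inner ℂ a (ballInvolution a z) =
      (1 - inner ℂ a z)⁻¹ * (1 - (‖a‖ : ℂ) ^ 2) := by
    have haa : (inner ℂ a a : ℂ) = (‖a‖ : ℂ) ^ 2 := inner_self_eq_norm_sq_to_K a
    rw [← inner_starProjection_singleton_self, hP, inner_smul_right, inner_sub_right, haa,
      inner_starProjection_singleton_self]
    field_simp
    ring
  rw [ballInvolution, hin, hP, ballInvolution]
  set s : ℂ := (Real.sqrt (1 - ‖a‖ ^ 2) : ℂ)
  set p := (ℂ ∙ a).starProjection z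
  set c : ℂ := inner ℂ a z
  have hvec : a - (1 - c)⁻¹ • (a - p) -
      s • ((1 - c)⁻¹ • (a - p - s • (z - p)) - (1 - c)⁻¹ • (a - p)) =
      ((1 - c)⁻¹ * (1 - (‖a‖ : ℂ) ^ 2)) • z := by
    have h1 : a = (1 - c)⁻¹ • (a - c • a) := by
      rw [← one_smul ℂ a, smul_smul, mul_one, ← sub_smul, smul_smul, inv_mul_cancel₀ hc]
    have h2 : s • ((1 - c)⁻¹ • (a - p - s • (z - p)) - (1 - c)⁻¹ • (a - p)) =
        -((1 - c)⁻¹ • (s ^ 2 • (z - p))) := by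
      module
    rw [h2, hs]
    nth_rewrite 1 [h1]
    rw [← hsm, mul_smul]
    module
  rw [hvec, smul_smul, inv_mul_cancel₀ (mul_ne_zero (inv_ne_zero hc) ha0), one_smul]

end BallInvolution

/-! ### Principal powers, covariance of the kernel, inner-product preserving maps. -/

section GammaKernel

open Complex

theorem Complex.abs_log_im_lt_of_re_pos {A : ℂ} (hA : 0 < A.re) : |(log A).im| < Real.pi / 2 := by
  rw [log_im]
  exact abs_arg_lt_pi_div_two_iff.mpr (Or.inl hA)

/-- The principal power is multiplicative on the relation `A * (B * C) = r * G` in the right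
half-plane, for positive real `r`. -/
theorem Complex.cpow_mul_cpow_of_re_pos {A B C G : ℂ} {r : ℝ} (hA : 0 < A.re) (hB : 0 < B.re)
    (hC : 0 < C.re) (hr : 0 < r) (hG : 0 < G.re) (h : A * (B * C) = r * G) (γ : ℂ) :
    A ^ γ * (B ^ γ * C ^ γ) = (r : ℂ) ^ γ * G ^ γ := by
  have ne : ∀ {z : ℂ}, 0 < z.re → z ≠ 0 := fun hz h0 => by simp [h0] at hz
  have hr0 : (r : ℂ) ≠ 0 := ofReal_ne_zero.mpr hr.ne'
  have hexp : exp (log A + (log B + log C)) = exp (log r + log G) := by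
    rw [exp_add, exp_add, exp_add, exp_log (ne hA), exp_log (ne hB), exp_log (ne hC),
      exp_log hr0, exp_log (ne hG), h]
  obtain ⟨n, hn⟩ := exp_eq_exp_iff_exists_int.mp hexp
  have him := congrArg Complex.im hn
  have hri : (log (r : ℂ)).im = 0 := by rw [log_im, arg_ofReal_of_nonneg hr.le]
  have hA' := abs_lt.mp (abs_log_im_lt_of_re_pos hA)
  have hB' := abs_lt.mp (abs_log_im_lt_of_re_pos hB)
  have hC' := abs_lt.mp (abs_log_im_lt_of_re_pos hC)
  have hG' := abs_lt.mp (abs_log_im_lt_of_re_pos hG)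
  have him' : (log A).im + ((log B).im + (log C).im) = (log G).im + n * (2 * Real.pi) := by
    have h2 : ((n : ℂ) * (2 * Real.pi * I)).im = n * (2 * Real.pi) := by simp
    rw [add_im, add_im, add_im, add_im, h2, hri, zero_add] at him
    exact him
  -- Four arguments, each strictly below `π/2` in modulus, give `|2πn| < 2π`; the positive `r`
  -- contributes none.
  have hlt : (n : ℝ) < 1 := by nlinarith [Real.pi_pos]
  have hgt : (-1 : ℝ) < n := by nlinarith [Real.pi_pos]
  have hn0 : n = 0 := by
    have h1 : n < 1 := by exact_mod_cast hlt
    have h2 : -1 < n := by exact_mod_cast hgt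
    omega
  rw [hn0, Int.cast_zero, zero_mul, add_zero] at hn
  rw [cpow_def_of_ne_zero (ne hA), cpow_def_of_ne_zero (ne hB), cpow_def_of_ne_zero (ne hC),
    cpow_def_of_ne_zero hr0, cpow_def_of_ne_zero (ne hG), ← exp_add, ← exp_add, ← exp_add,
    ← add_mul, ← add_mul, ← add_mul, hn]

variable {E : Type*} [NormedAddCommGroup E] [InnerProductSpace ℂ E] {γ : ℝ}

theorem gammaKernel_ne_zero {z w : E} (hz : ‖z‖ < 1) (hw : ‖w‖ < 1) : gammaKernel γ z w ≠ 0 :=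
  one_div_ne_zero fun h => one_sub_inner_ne_zero hz hw ((cpow_eq_zero_iff _ _).mp h).1

theorem gammaKernel_zero_right (z : E) : gammaKernel γ z 0 = 1 := by simp [gammaKernel]

theorem star_gammaKernel {z w : E} (hz : ‖z‖ < 1) (hw : ‖w‖ < 1) :
    star (gammaKernel γ z w) = gammaKernel γ w z := by
  have harg : (1 - inner ℂ w z : ℂ).arg ≠ Real.pi := fun h => by
    have h1 := abs_arg_lt_pi_div_two_iff.mpr (Or.inl (re_one_sub_inner_pos hz hw))
    rw [h, abs_of_pos Real.pi_pos] at h1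
    linarith [Real.pi_pos]
  have h := cpow_conj (1 - inner ℂ w z : ℂ) (γ : ℂ) harg
  rw [map_sub, map_one, inner_conj_symm, conj_ofReal] at h
  rw [gammaKernel, gammaKernel, h, ← starRingEnd_apply, map_div₀, map_one,
    conj_conj]

theorem gammaKernel_self {a : E} (ha : ‖a‖ < 1) :
    gammaKernel γ a a = (((1 - ‖a‖ ^ 2) ^ γ)⁻¹ : ℝ) := by
  have haa : (inner ℂ a a : ℂ) = (‖a‖ : ℂ) ^ 2 := inner_self_eq_norm_sq_to_K a
  rw [gammaKernel, haa, ofReal_inv, ofReal_cpow (by nlinarith [norm_nonneg a]), one_div]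
  push_cast
  rfl

/-- `K(a,a)` is a positive real, so its principal half power is the ordinary square root. -/
theorem exists_gammaKernel_self_cpow_half {a : E} (ha : ‖a‖ < 1) :
    ∃ r : ℝ, 0 < r ∧ gammaKernel γ a a ^ (1 / 2 : ℂ) = r ∧ gammaKernel γ a a = (r : ℂ) ^ 2 := by
  have hpos : 0 < ((1 - ‖a‖ ^ 2) ^ γ)⁻¹ :=
    inv_pos.mpr (Real.rpow_pos_of_pos (by nlinarith [norm_nonneg a]) _)
  refine ⟨(((1 - ‖a‖ ^ 2) ^ γ)⁻¹) ^ (1 / 2 : ℝ), Real.rpow_pos_of_pos hpos _, ?_, ?_⟩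
  · rw [gammaKernel_self ha, ofReal_cpow hpos.le]
    norm_num
  · rw [gammaKernel_self ha, ← ofReal_pow, ← Real.sqrt_eq_rpow, Real.sq_sqrt hpos.le]

/-- The kernel transforms covariantly under the involution `φ_a`. -/
theorem gammaKernel_ballInvolution {a z w : E} (ha : ‖a‖ < 1) (hz : ‖z‖ < 1) (hw : ‖w‖ < 1) :
    gammaKernel γ z a * gammaKernel γ a w *
        gammaKernel γ (ballInvolution a z) (ballInvolution a w) =
      gammaKernel γ a a * gammaKernel γ z w := by
  have h := one_sub_inner_ballInvolution ha hz hw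
  have hr : 0 < 1 - ‖a‖ ^ 2 := by nlinarith [norm_nonneg a]
  have hpow := cpow_mul_cpow_of_re_pos
    (re_one_sub_inner_pos (norm_ballInvolution_lt_one ha hz) (norm_ballInvolution_lt_one ha hw))
    (re_one_sub_inner_pos hz ha) (re_one_sub_inner_pos ha hw) hr (re_one_sub_inner_pos hz hw)
    (by rw [h]; push_cast; rfl) (γ : ℂ)
  rw [gammaKernel_self ha, ofReal_inv, ofReal_cpow hr.le]
  simp only [gammaKernel, one_div]
  rw [← mul_inv, ← mul_inv, ← mul_inv, ← hpow]
  ring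

theorem gammaKernel_weighted_ballInvolution {a z w : E} (ha : ‖a‖ < 1) (hz : ‖z‖ < 1)
    (hw : ‖w‖ < 1) :
    gammaKernel γ z a / gammaKernel γ a a ^ (1 / 2 : ℂ) *
        star (gammaKernel γ w a / gammaKernel γ a a ^ (1 / 2 : ℂ)) *
        gammaKernel γ (ballInvolution a z) (ballInvolution a w) =
      gammaKernel γ z w := by
  obtain ⟨r, hr, hr1, hr2⟩ := exists_gammaKernel_self_cpow_half (γ := γ) ha
  have h := gammaKernel_ballInvolution (γ := γ) ha hz hw
  have hr0 : (r : ℂ) ≠ 0 := ofReal_ne_zero.mpr hr.ne'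
  have hstar : star (gammaKernel γ w a / (r : ℂ)) = gammaKernel γ a w / r := by
    rw [← starRingEnd_apply, map_div₀, conj_ofReal, starRingEnd_apply, star_gammaKernel hw ha]
  rw [hr1, hstar]
  rw [hr2] at h
  field_simp
  linear_combination h

/-- A map that preserves all inner products is a linear isometry. -/
theorem exists_linearIsometry_of_inner_eq {F : Type*} [NormedAddCommGroup F]
    [InnerProductSpace ℂ F] (f : E → F) (hf : ∀ x y, inner ℂ (f x) (f y) = inner ℂ x y) :
    ∃ V : E →ₗᵢ[ℂ] F, ∀ x, V x = f x := by
  refine ⟨⟨⟨⟨f, fun x y => ?_⟩, fun c x => ?_⟩, fun x => ?_⟩, fun x => rfl⟩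
  -- The squared norm of the additivity defect expands into inner products that `f` preserves;
  -- likewise for homogeneity.
  · rw [← sub_eq_zero, ← inner_self_eq_zero (𝕜 := ℂ)]
    simp only [inner_sub_left, inner_sub_right, inner_add_left, inner_add_right, hf]
    ring
  · rw [← sub_eq_zero, ← inner_self_eq_zero (𝕜 := ℂ)]
    simp only [inner_sub_left, inner_sub_right, inner_smul_left, inner_smul_right, hf,
      RingHom.id_apply]
    ring
  · change ‖f x‖ = ‖x‖
    rw [@norm_eq_sqrt_re_inner ℂ, hf, ← @norm_eq_sqrt_re_inner ℂ]

/-- A self-map of the ball that preserves inner products is the restriction of a linear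
isometry. -/
theorem exists_linearIsometry_of_inner_eq_on_ball (ψ : UnitBall E → UnitBall E)
    (hψ : ∀ z w, inner ℂ (ψ z : E) (ψ w : E) = inner ℂ (z : E) (w : E)) :
    ∃ V : E →ₗᵢ[ℂ] E, ∀ z, (ψ z : E) = V z := by
  -- Dividing by `‖x‖ + 1` moves any vector into the ball; rescaling afterwards extends `ψ` to all
  -- of `E`.
  have hlt : ∀ x : E, ‖((‖x‖ + 1 : ℝ) : ℂ)⁻¹ • x‖ < 1 := fun x => by
    have hp : 0 < ‖x‖ + 1 := by positivity
    rw [norm_smul, norm_inv, norm_real, Real.norm_of_nonneg hp.le, inv_mul_lt_one₀ hp]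
    linarith
  have hne : ∀ x : E, ((‖x‖ + 1 : ℝ) : ℂ) ≠ 0 := fun x =>
    ofReal_ne_zero.mpr (by positivity)
  obtain ⟨V, hV⟩ := exists_linearIsometry_of_inner_eq
    (fun x : E => ((‖x‖ + 1 : ℝ) : ℂ) • (ψ ⟨_, hlt x⟩ : E)) fun x y => by
      simp only [inner_smul_left, inner_smul_right, hψ, map_inv₀, conj_ofReal]
      have hx := hne x
      have hy := hne y
      generalize ((‖x‖ + 1 : ℝ) : ℂ) = r at *
      generalize ((‖y‖ + 1 : ℝ) : ℂ) = s at *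
      field_simp
  refine ⟨V, fun z => ?_⟩
  have h1 : inner ℂ (ψ z : E) (V z) = inner ℂ (z : E) (z : E) := by
    rw [hV, inner_smul_right, hψ, inner_smul_right, mul_inv_cancel_left₀ (hne z)]
  have h2 : inner ℂ (V z) (ψ z : E) = inner ℂ (z : E) (z : E) := by
    rw [← inner_conj_symm, h1, inner_conj_symm]
  rw [← sub_eq_zero, ← inner_self_eq_zero (𝕜 := ℂ), inner_sub_left, inner_sub_right,
    inner_sub_right, hψ, h1, h2, V.inner_map_map]
  ring

/-! ### Rigidity: maps preserving the kernel preserve inner products. -/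

section Rigidity

variable {ψ : UnitBall E → UnitBall E}

theorem norm_one_sub_inner_eq_of_gammaKernel_eq (hγ : 0 < γ)
    (hψ : ∀ z w, gammaKernel γ (ψ z : E) (ψ w : E) = gammaKernel γ (z : E) (w : E))
    (z w : UnitBall E) :
    ‖(1 - inner ℂ (ψ w : E) (ψ z : E) : ℂ)‖ = ‖(1 - inner ℂ (w : E) (z : E) : ℂ)‖ := by
  have h := congrArg norm (hψ z w)
  have hc : ∀ z w : UnitBall E, ‖gammaKernel γ (z : E) (w : E)‖ =
      (‖(1 - inner ℂ (w : E) (z : E) : ℂ)‖ ^ γ)⁻¹ := fun z w => by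
    rw [gammaKernel, norm_div, norm_one, one_div, norm_cpow_real]
  rw [hc, hc, inv_inj] at h
  exact (Real.rpow_left_inj (norm_nonneg _) (norm_nonneg _) hγ.ne').mp h

theorem norm_eq_of_gammaKernel_eq (hγ : 0 < γ)
    (hψ : ∀ z w, gammaKernel γ (ψ z : E) (ψ w : E) = gammaKernel γ (z : E) (w : E))
    (z : UnitBall E) : ‖(ψ z : E)‖ = ‖(z : E)‖ := by
  have h := norm_one_sub_inner_eq_of_gammaKernel_eq hγ hψ z z
  have hc : ∀ z : UnitBall E, ‖(1 - inner ℂ (z : E) (z : E) : ℂ)‖ = 1 - ‖(z : E)‖ ^ 2 := fun z => by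
    have hzz : (inner ℂ (z : E) (z : E) : ℂ) = (‖(z : E)‖ : ℂ) ^ 2 := inner_self_eq_norm_sq_to_K _
    rw [hzz, ← ofReal_pow, ← ofReal_one, ← ofReal_sub, norm_real, Real.norm_of_nonneg]
    nlinarith [norm_nonneg (z : E), z.2]
  rw [hc, hc] at h
  exact (sq_eq_sq₀ (norm_nonneg _) (norm_nonneg _)).mp (by linarith)

/-- No continuity is assumed: it follows from the invariance of the kernel. -/
theorem continuous_of_gammaKernel_eq (hγ : 0 < γ)
    (hψ : ∀ z w, gammaKernel γ (ψ z : E) (ψ w : E) = gammaKernel γ (z : E) (w : E)) :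
    Continuous fun z => (ψ z : E) := by
  rw [continuous_iff_continuousAt]
  intro w
  -- Expand `‖ψ z - ψ w‖²` and use `-Re⟨ψ z, ψ w⟩ ≤ |1 - ⟨ψ z, ψ w⟩| - 1`; norms and this modulus
  -- are invariant, so the bound no longer involves `ψ`.
  set g : UnitBall E → ℝ := fun z =>
    ‖(z : E)‖ ^ 2 + ‖(w : E)‖ ^ 2 - 2 + 2 * ‖(1 - inner ℂ (w : E) (z : E) : ℂ)‖ with hg
  have hle : ∀ z, ‖(ψ z : E) - ψ w‖ ^ 2 ≤ g z := by
    intro z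
    have hre := Complex.re_le_norm (1 - inner ℂ (ψ w : E) (ψ z : E))
    rw [norm_one_sub_inner_eq_of_gammaKernel_eq hγ hψ, sub_re, one_re] at hre
    have hsymm : RCLike.re (inner ℂ (ψ z : E) (ψ w : E) : ℂ) =
        (inner ℂ (ψ w : E) (ψ z : E) : ℂ).re := inner_re_symm _ _
    rw [@norm_sub_sq ℂ, hsymm, norm_eq_of_gammaKernel_eq hγ hψ, norm_eq_of_gammaKernel_eq hγ hψ]
    simp only [hg]
    linarith
  have hg0 : g w = 0 := by
    have hww : (inner ℂ (w : E) (w : E) : ℂ) = (‖(w : E)‖ : ℂ) ^ 2 := inner_self_eq_norm_sq_to_K _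
    have hnn : 0 ≤ 1 - ‖(w : E)‖ ^ 2 := by nlinarith [norm_nonneg (w : E), w.2]
    simp only [hg]
    rw [hww, ← ofReal_pow, ← ofReal_one, ← ofReal_sub, norm_real, Real.norm_of_nonneg hnn]
    ring
  have hgc : Continuous g := by fun_prop
  have ht : Filter.Tendsto g (nhds w) (nhds 0) := hg0 ▸ hgc.tendsto w
  have hsq := squeeze_zero (fun z => sq_nonneg _) hle ht
  rw [ContinuousAt, tendsto_iff_norm_sub_tendsto_zero]
  have := hsq.sqrt
  simpa [Real.sqrt_sq] using this

/-- Equal `γ`-th powers leave the logarithms ambiguous by `2πin/γ`, a real ambiguity for large `γ`.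
Along the segment from `0` to `z` the integer `n` varies continuously, so it is constant, and it
vanishes at `0` because `ψ 0 = 0`. -/
theorem inner_eq_of_gammaKernel_eq (hγ : 0 < γ)
    (hψ : ∀ z w, gammaKernel γ (ψ z : E) (ψ w : E) = gammaKernel γ (z : E) (w : E))
    (z w : UnitBall E) :
    inner ℂ (ψ w : E) (ψ z : E) = inner ℂ (w : E) (z : E) := by
  have hlt : ∀ t : unitInterval, ‖((t : ℝ) : ℂ) • (z : E)‖ < 1 := fun t => by
    rw [norm_smul, norm_real, Real.norm_of_nonneg t.2.1]
    exact (mul_le_of_le_one_left (norm_nonneg _) t.2.2).trans_lt z.2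
  set p : unitInterval → UnitBall E := fun t => ⟨_, hlt t⟩ with hp
  have hpc : Continuous p := by
    refine Continuous.subtype_mk ?_ _
    fun_prop
  set u : unitInterval → ℂ := fun t => 1 - inner ℂ (ψ w : E) (ψ (p t) : E) with hu
  set v : unitInterval → ℂ := fun t => 1 - inner ℂ (w : E) (p t : E) with hv
  have hure : ∀ t, 0 < (u t).re := fun t => re_one_sub_inner_pos (ψ (p t)).2 (ψ w).2
  have hvre : ∀ t, 0 < (v t).re := fun t => re_one_sub_inner_pos (p t).2 w.2
  have huc : Continuous u := continuous_const.sub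
    (continuous_const.inner ((continuous_of_gammaKernel_eq hγ hψ).comp hpc))
  have hvc : Continuous v := continuous_const.sub
    (continuous_const.inner (continuous_subtype_val.comp hpc))
  have hu0 : ∀ t, u t ≠ 0 := fun t => one_sub_inner_ne_zero (ψ (p t)).2 (ψ w).2
  have hv0 : ∀ t, v t ≠ 0 := fun t => one_sub_inner_ne_zero (p t).2 w.2
  have hpow : ∀ t, u t ^ (γ : ℂ) = v t ^ (γ : ℂ) := fun t => by
    have h := hψ (p t) w
    simpa only [gammaKernel, one_div, inv_inj] using h
  have hint : ∀ t, ∃ n : ℤ,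
      log (u t) * γ = log (v t) * γ + n * (2 * Real.pi * I) := fun t => by
    have h := hpow t
    rwa [cpow_def_of_ne_zero (hu0 t), cpow_def_of_ne_zero (hv0 t),
      exp_eq_exp_iff_exists_int] at h
  choose n hn using hint
  have hcast : ∀ t, ((n t : ℤ) : ℝ) =
      ((log (u t) * γ).im - (log (v t) * γ).im) / (2 * Real.pi) := fun t => by
    have h2 : ((n t : ℂ) * (2 * Real.pi * I)).im = n t * (2 * Real.pi) := by simp
    rw [hn t, add_im, h2]
    field_simp [Real.pi_pos.ne']
    ring
  have hlu : Continuous fun t => log (u t) := huc.clog fun t => Or.inl (hure t)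
  have hlv : Continuous fun t => log (v t) := hvc.clog fun t => Or.inl (hvre t)
  have hnc : Continuous n := by
    rw [Int.isClosedEmbedding_coe_real.isInducing.continuous_iff]
    have : ((fun k : ℤ => (k : ℝ)) ∘ n) = fun t =>
        ((log (u t) * γ).im - (log (v t) * γ).im) / (2 * Real.pi) := funext hcast
    rw [this]
    exact ((Complex.continuous_im.comp (hlu.mul continuous_const)).sub
      (Complex.continuous_im.comp (hlv.mul continuous_const))).div_const _
  have hp0 : ψ (p 0) = p 0 := by
    have h0 : (p 0 : E) = 0 := by simp [hp]
    have h := norm_eq_of_gammaKernel_eq hγ hψ (p 0)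
    rw [h0, norm_zero, norm_eq_zero] at h
    exact Subtype.ext (h.trans h0.symm)
  have hn0 : n 0 = 0 := by
    have h0 : (p 0 : E) = 0 := by simp [hp]
    have h1 : u 0 = v 0 := by simp only [hu, hv, hp0, h0, inner_zero_right]
    have h2 := hcast 0
    rw [h1, sub_self, zero_div] at h2
    exact_mod_cast h2
  have hn1 : n 1 = 0 := (PreconnectedSpace.constant inferInstance hnc).trans hn0
  have hp1 : p 1 = z := Subtype.ext (by simp [hp])
  have hlog := hn 1
  rw [hn1, Int.cast_zero, zero_mul, add_zero] at hlog
  have hlog' := mul_right_cancel₀ (ofReal_ne_zero.mpr hγ.ne') hlog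
  have huv : u 1 = v 1 := by rw [← exp_log (hu0 1), hlog', exp_log (hv0 1)]
  simpa only [hu, hv, hp1, sub_right_inj] using huv

end Rigidity

end GammaKernel

/-! ### Solving the covariance equation. -/

section Main

variable {E : Type*} [NormedAddCommGroup E] [InnerProductSpace ℂ E] {γ : ℝ}

theorem isCoisometricWCO_HGamma_iff (hγ : 0 < γ) (φ : UnitBall E → UnitBall E)
    (δ : UnitBall E → ℂ) :
    IsCoisometricWCO (HGamma E hγ) δ φ ↔ ∀ z w : UnitBall E,
      δ z * star (δ w) * gammaKernel γ (φ z : E) (φ w : E) = gammaKernel γ (z : E) (w : E) := by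
  rw [isCoisometricWCO_iff, HGamma.kernel_eq]
  simp [gammaKernelMatrix]

theorem gammaKernel_covariant_of_eq {φ : UnitBall E → UnitBall E} {δ : UnitBall E → ℂ}
    (a : UnitBall E) (V : E →ₗᵢ[ℂ] E) {μ : ℂ} (hμ : ‖μ‖ = 1)
    (hφ : ∀ z : UnitBall E, (φ z : E) = ballInvolution (a : E) (V z))
    (hδ : ∀ z : UnitBall E, δ z = μ * (gammaKernel γ (V z) (a : E) /
      gammaKernel γ (a : E) (a : E) ^ (1 / 2 : ℂ))) (z w : UnitBall E) :
    δ z * star (δ w) * gammaKernel γ (φ z : E) (φ w : E) = gammaKernel γ (z : E) (w : E) := by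
  have hV : ∀ z : UnitBall E, ‖V z‖ < 1 := fun z => by rw [V.norm_map]; exact z.2
  have h := gammaKernel_weighted_ballInvolution (γ := γ) a.2 (hV z) (hV w)
  have hinv : gammaKernel γ (V z) (V w) = gammaKernel γ (z : E) (w : E) := by
    rw [gammaKernel, V.inner_map_map, gammaKernel]
  have hμ' : μ * star μ = 1 := by
    rw [← starRingEnd_apply, Complex.mul_conj, Complex.normSq_eq_norm_sq, hμ]
    simp
  rw [hδ, hδ, hφ, hφ, star_mul', ← hinv, ← h]
  linear_combination (gammaKernel γ (V z) (a : E) / gammaKernel γ (a : E) (a : E) ^ (1 / 2 : ℂ) *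
    star (gammaKernel γ (V w) (a : E) / gammaKernel γ (a : E) (a : E) ^ (1 / 2 : ℂ)) *
    gammaKernel γ (ballInvolution (a : E) (V z)) (ballInvolution (a : E) (V w))) * hμ'

theorem exists_eq_of_gammaKernel_covariant (hγ : 0 < γ) {φ : UnitBall E → UnitBall E}
    {δ : UnitBall E → ℂ}
    (h : ∀ z w : UnitBall E,
      δ z * star (δ w) * gammaKernel γ (φ z : E) (φ w : E) = gammaKernel γ (z : E) (w : E)) :
    ∃ (a : UnitBall E) (V : E →ₗᵢ[ℂ] E) (μ : ℂ), ‖μ‖ = 1 ∧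
      (∀ z : UnitBall E, (φ z : E) = ballInvolution (a : E) (V z)) ∧
      (∀ z : UnitBall E, δ z = μ * (gammaKernel γ (V z) (a : E) /
        gammaKernel γ (a : E) (a : E) ^ (1 / 2 : ℂ))) := by
  set o : UnitBall E := ⟨0, by simp⟩ with ho
  -- Forced, since `φ_a (V 0) = φ_a 0 = a`.
  set a := φ o with ha
  set ψ : UnitBall E → UnitBall E := fun z =>
    ⟨ballInvolution (a : E) (φ z), norm_ballInvolution_lt_one a.2 (φ z).2⟩ with hψ
  have hφψ : ∀ z, (φ z : E) = ballInvolution (a : E) (ψ z) := fun z =>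
    (ballInvolution_ballInvolution a.2 (φ z).2).symm
  have hψo : (ψ o : E) = 0 := ballInvolution_self _
  -- The expected weight with `μ = 1`, with `ψ` in place of `V`.
  set D : UnitBall E → ℂ := fun z => gammaKernel γ (ψ z : E) (a : E) /
    gammaKernel γ (a : E) (a : E) ^ (1 / 2 : ℂ) with hD
  have hDK : ∀ z w, D z * star (D w) * gammaKernel γ (φ z : E) (φ w : E) =
      gammaKernel γ (ψ z : E) (ψ w : E) := fun z w => by
    rw [hφψ z, hφψ w]
    exact gammaKernel_weighted_ballInvolution a.2 (ψ z).2 (ψ w).2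
  -- At `w = 0` both right-hand kernels equal `1`, and the nonzero factor `K (φ z) (φ 0)` cancels.
  have hprod : ∀ z, δ z * star (δ o) = D z * star (D o) := fun z => by
    have h1 := h z o
    have h2 := hDK z o
    rw [hψo, gammaKernel_zero_right] at h2
    rw [gammaKernel_zero_right, ← h2] at h1
    exact mul_right_cancel₀ (gammaKernel_ne_zero (φ z).2 (φ o).2) h1
  have hδo : star (δ o) ≠ 0 := fun h0 => by
    have h1 := h o o
    rw [h0, mul_zero, zero_mul] at h1
    exact gammaKernel_ne_zero o.2 o.2 h1.symm
  set μ : ℂ := star (D o) / star (δ o) with hμ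
  have hδD : ∀ z, δ z = μ * D z := fun z => by
    rw [hμ, div_mul_eq_mul_div, eq_div_iff hδo, hprod, mul_comm]
  have hμ1 : ‖μ‖ = 1 := by
    have h1 := congrArg norm (hprod o)
    rw [norm_mul, norm_mul, norm_star, norm_star] at h1
    have h2 := (mul_self_inj (norm_nonneg _) (norm_nonneg _)).mp h1
    rw [hμ, norm_div, norm_star, norm_star, h2, div_self]
    rw [← h2, ← norm_star]
    exact norm_ne_zero_iff.mpr hδo
  have hμ2 : μ * star μ = 1 := by
    rw [← starRingEnd_apply, Complex.mul_conj, Complex.normSq_eq_norm_sq, hμ1]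
    simp
  have hψK : ∀ z w, gammaKernel γ (ψ z : E) (ψ w : E) = gammaKernel γ (z : E) (w : E) :=
    fun z w => by
      rw [← hDK, ← h z w, hδD, hδD, star_mul']
      linear_combination (-(D z * star (D w) * gammaKernel γ (φ z : E) (φ w : E))) * hμ2
  obtain ⟨V, hV⟩ := exists_linearIsometry_of_inner_eq_on_ball ψ fun z w =>
    inner_eq_of_gammaKernel_eq hγ hψK w z
  refine ⟨a, V, μ, hμ1, fun z => ?_, fun z => ?_⟩
  · rw [← hV, hφψ]
  · rw [hδD, ← hV]

end Main

theorem theorem4p1 (d : ℕ∞) (γ : ℝ) (hγ : 0 < γ)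
    (φ : UnitBall (Cd d) → UnitBall (Cd d)) (δ : UnitBall (Cd d) → ℂ) :
    IsCoisometricWCO (HGamma (Cd d) hγ) δ φ ↔
      ∃ (a : UnitBall (Cd d)) (V : Cd d →ₗᵢ[ℂ] Cd d) (μ : ℂ), ‖μ‖ = 1 ∧
        (∀ z : UnitBall (Cd d), (φ z : Cd d) = ballInvolution (a : Cd d) (V z)) ∧
        (∀ z : UnitBall (Cd d),
          δ z = μ * (gammaKernel γ (V z) (a : Cd d) /
            gammaKernel γ (a : Cd d) (a : Cd d) ^ (1 / 2 : ℂ))) := by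
  rw [isCoisometricWCO_HGamma_iff]
  constructor
  · exact exists_eq_of_gammaKernel_covariant hγ
  · rintro ⟨a, V, μ, hμ, hφ, hδ⟩
    exact gammaKernel_covariant_of_eq a V hμ hφ hδ
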